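/- Let $k\ge 1$. Partitions are ordered by containment of diagrams, $\lambda\subseteq\mu$ meaning $\lambda_i\le\mu_i$ for all $i$, and $|\lambda|=\sum_i\lambda_i$ is the degree of $\lambda$. A partition is $k$-bounded if its first part is at most $k$. For a skew shape $\gamma/\rho$ and a square $s\in\gamma$ (possibly $s\in\rho$), the hook-length of $s$ is the number of cells of $\gamma/\rho$ that lie in the row of $s$ weakly to the right of $s$, or in the column of $s$ weakly on the side of the shorter rows. The $k$-skew diagram of a $k$-bounded partition $\lambda$ is the unique skew shape $\gamma/\rho$ whose $i$-th row has $\lambda_i$ cells for every $i$, all of whose cells have hook-length at most $k$, and for which every square of $\rho$ has hook-length greater than $k$. The column lengths of this diagram form a $k$-bounded partition, the $k$-conjugate $\lambda^{\omega_k}$. The $k$-Young lattice $Y^k$ is the set of $k$-bounded partitions with the order $\preceq$ that is the reflexive transitive closure of the relation $$\lambda\prec\!\!\cdot\,\mu\iff \lambda\subseteq\mu,\quad \lambda^{\omega_k}\subseteq\mu^{\omega_k},\quad |\mu|=|\lambda|+1 .$$ For $m\le k$ let $L^k(m,n)=\{\mu\in Y^k:\mu\preceq(m^n)\}$ be the principal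 order ideal generated by the rectangular partition $(m^n)=(m,\dots,m)$ with $n$ parts, with the induced order; the rank of an element is the maximal length $r$ of a chain $x_0\prec x_1\prec\cdots\prec x_r$ in $L^k(m,n)$ ending at it. In the field $\mathbb{Q}(q)$ put $$\begin{bmatrix}a\\b\end{bmatrix}_q=\prod_{i=1}^{b}\frac{1-q^{a-b+i}}{1-q^i}\qquad(0\le b\le a).$$ **Theorem.** Let $1\le m\le k$ and $n\ge k-m+1$. Then $L^k(m,n)$ is finite, the rank of each $\lambda\in L^k(m,n)$ is its degree $|\lambda|$, the rank-generating function of $L^k(m,n)$ is $$\sum_{\lambda\in L^k(m,n)}q^{\operatorname{rank}\lambda}=\begin{bmatrix}k+1\\m\end{bmatrix}_q+q^{k+1}\,\frac{1-q^{m(n-k+m-1)}}{1-q^m}\begin{bmatrix}k\\m-1\end{bmatrix}_q ,$$ and the number of elements is $$\left|L^k(m,n)\right|=\binom{k+1}{m}+(n-k+m-1)\binom{k}{m-1}.$$ -/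

import Mathlib

/-! Partitions are Young diagrams: the cell `(i, j)` lies in row `i` and column `j`, both counted
from `0`, and row `0` is the longest row. Containment of partitions is `≤` on `YoungDiagram`. -/

namespace KYoung

/-- A partition is `k`-bounded if its first part is at most `k`. -/
def IsBounded (k : ℕ) (lam : YoungDiagram) : Prop := lam.rowLen 0 ≤ k

/-- The cells of the skew shape `γ/ρ`. -/
def skewCells (γ ρ : YoungDiagram) : Finset (ℕ × ℕ) := γ.cells \ ρ.cells

/-- The hook-length of the square `s` in the skew shape `γ/ρ`: the number of cells of `γ/ρ` lying
in the L with corner `s`, that is, in the row of `s` weakly to the right of `s`, or in the column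
of `s` weakly beyond `s`. The square `s` may itself be a square of `ρ`. -/
def hookLen (γ ρ : YoungDiagram) (s : ℕ × ℕ) : ℕ :=
  ((skewCells γ ρ).filter fun c => (c.1 = s.1 ∧ s.2 ≤ c.2) ∨ (c.2 = s.2 ∧ s.1 ≤ c.1)).card

/-- The number of cells of `γ/ρ` in row `i`. -/
def skewRow (γ ρ : YoungDiagram) (i : ℕ) : ℕ := ((skewCells γ ρ).filter fun c => c.1 = i).card

/-- The number of cells of `γ/ρ` in column `j`. -/
def skewCol (γ ρ : YoungDiagram) (j : ℕ) : ℕ := ((skewCells γ ρ).filter fun c => c.2 = j).card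

/-- `γ/ρ` is the `k`-skew diagram of the partition `lam`: its rows are the rows of `lam`, no cell
has a hook-length exceeding `k`, and every square below it (every square of `ρ`) has a hook-length
exceeding `k`. -/
structure IsKSkew (k : ℕ) (lam γ ρ : YoungDiagram) : Prop where
  le : ρ ≤ γ
  row : ∀ i, skewRow γ ρ i = lam.rowLen i
  hook_le : ∀ s ∈ skewCells γ ρ, hookLen γ ρ s ≤ k
  lt_hook : ∀ s ∈ ρ, k < hookLen γ ρ s

/-- `ν` is the `k`-conjugate of `lam`: its parts are the columns of the `k`-skew diagram of
`lam`. -/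
def IsKConj (k : ℕ) (lam ν : YoungDiagram) : Prop :=
  ∃ γ ρ, IsKSkew k lam γ ρ ∧ ∀ j, ν.rowLen j = skewCol γ ρ j

/-! ### Existence and uniqueness of the `k`-skew diagram and of the `k`-conjugate -/

/-- The number of cells of `γ/ρ` in column `j` strictly beyond row `i`. -/
def colBeyond (γ ρ : YoungDiagram) (i j : ℕ) : ℕ :=
  ((skewCells γ ρ).filter fun c => c.2 = j ∧ i < c.1).card

theorem mem_skewCells {γ ρ : YoungDiagram} {i j : ℕ} :
    (i, j) ∈ skewCells γ ρ ↔ ρ.rowLen i ≤ j ∧ j < γ.rowLen i := by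
  simp [skewCells, YoungDiagram.mem_iff_lt_rowLen, and_comm]

theorem skewRow_eq (γ ρ : YoungDiagram) (i : ℕ) :
    skewRow γ ρ i = γ.rowLen i - ρ.rowLen i := by
  have : (skewCells γ ρ).filter (fun c => c.1 = i)
      = (Finset.Ico (ρ.rowLen i) (γ.rowLen i)).image (fun j => (i, j)) := by
    ext ⟨a, b⟩
    simp only [Finset.mem_filter, mem_skewCells, Finset.mem_image, Finset.mem_Ico, Prod.mk.injEq]
    constructor
    · rintro ⟨h, rfl⟩; exact ⟨b, h, rfl, rfl⟩
    · rintro ⟨c, h, rfl, rfl⟩; exact ⟨h, rfl⟩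
  rw [skewRow, this, Finset.card_image_of_injective _ (fun a b h => (Prod.mk.inj h).2),
    Nat.card_Ico]

theorem hookLen_eq (γ ρ : YoungDiagram) (i j : ℕ) :
    hookLen γ ρ (i, j) = (γ.rowLen i - max (ρ.rowLen i) j) + colBeyond γ ρ i j := by
  have : (skewCells γ ρ).filter
      (fun c => (c.1 = i ∧ j ≤ c.2) ∨ (c.2 = j ∧ i ≤ c.1))
      = (Finset.Ico (max (ρ.rowLen i) j) (γ.rowLen i)).image (fun j => (i, j)) ∪
        (skewCells γ ρ).filter fun c => c.2 = j ∧ i < c.1 := by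
    ext ⟨a, b⟩
    simp only [Finset.mem_filter, mem_skewCells, Finset.mem_image, Finset.mem_Ico, Prod.mk.injEq,
      Finset.mem_union]
    constructor
    · rintro ⟨h, ⟨rfl, h'⟩ | ⟨rfl, h'⟩⟩
      · left; exact ⟨b, ⟨by omega, h.2⟩, rfl, rfl⟩
      · rcases h'.eq_or_lt with rfl | h'
        · left; exact ⟨b, ⟨by omega, h.2⟩, rfl, rfl⟩
        · right; exact ⟨h, rfl, h'⟩
    · rintro (⟨c, h, rfl, rfl⟩ | ⟨h, rfl, h'⟩)
      · exact ⟨⟨by omega, h.2⟩, Or.inl ⟨rfl, by omega⟩⟩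
      · exact ⟨h, Or.inr ⟨rfl, h'.le⟩⟩
  rw [hookLen, this, Finset.card_union_of_disjoint,
    Finset.card_image_of_injective _ (fun a b h => (Prod.mk.inj h).2), Nat.card_Ico, colBeyond]
  rw [Finset.disjoint_left]
  simp only [Finset.mem_image, Finset.mem_filter]
  rintro _ ⟨c, _, rfl⟩ ⟨_, _, h⟩
  exact lt_irrefl _ h

theorem eq_of_rowLen {μ ν : YoungDiagram} (h : ∀ i, μ.rowLen i = ν.rowLen i) : μ = ν := by
  ext ⟨i, j⟩
  simp [YoungDiagram.mem_iff_lt_rowLen, h]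

theorem rowLen_eq_zero (μ : YoungDiagram) {i : ℕ} (h : μ.colLen 0 ≤ i) : μ.rowLen i = 0 := by
  by_contra h0
  have := YoungDiagram.mem_iff_lt_colLen.1 (YoungDiagram.mem_iff_lt_rowLen.2 (Nat.pos_of_ne_zero h0))
  omega

theorem colBeyond_congr {γ ρ γ' ρ' : YoungDiagram} {i : ℕ}
    (hγ : ∀ a, i < a → γ.rowLen a = γ'.rowLen a) (hρ : ∀ a, i < a → ρ.rowLen a = ρ'.rowLen a)
    (j : ℕ) : colBeyond γ ρ i j = colBeyond γ' ρ' i j := by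
  unfold colBeyond
  congr 1
  ext ⟨a, b⟩
  simp only [Finset.mem_filter, mem_skewCells]
  constructor
  · rintro ⟨h, h1, h2⟩; rw [hγ a h2, hρ a h2] at h; exact ⟨h, h1, h2⟩
  · rintro ⟨h, h1, h2⟩; rw [← hγ a h2, ← hρ a h2] at h; exact ⟨h, h1, h2⟩

theorem IsKSkew.rowLen_eq {k : ℕ} {lam γ ρ : YoungDiagram} (h : IsKSkew k lam γ ρ) (i : ℕ) :
    γ.rowLen i = ρ.rowLen i + lam.rowLen i := by
  have h1 := h.row i
  rw [skewRow_eq] at h1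
  have h2 : ρ.rowLen i ≤ γ.rowLen i := by
    by_contra hlt
    have hm : (i, γ.rowLen i) ∈ ρ := YoungDiagram.mem_iff_lt_rowLen.2 (not_le.1 hlt)
    exact lt_irrefl _ (YoungDiagram.mem_iff_lt_rowLen.1 (h.le hm))
  omega

theorem IsKSkew.rowLen_le {k : ℕ} {lam γ ρ γ' ρ' : YoungDiagram}
    (h : IsKSkew k lam γ ρ) (h' : IsKSkew k lam γ' ρ') (i : ℕ)
    (e : ∀ a, i < a → ρ.rowLen a = ρ'.rowLen a) : ρ'.rowLen i ≤ ρ.rowLen i := by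
  by_contra hlt
  rw [not_le] at hlt
  have e' : ∀ a, i < a → γ.rowLen a = γ'.rowLen a := fun a ha => by
    rw [h.rowLen_eq, h'.rowLen_eq, e a ha]
  have h1 := h'.lt_hook (i, ρ.rowLen i) (YoungDiagram.mem_iff_lt_rowLen.2 hlt)
  rw [hookLen_eq, ← colBeyond_congr e' e, h'.rowLen_eq, max_eq_left hlt.le] at h1
  rcases Nat.eq_zero_or_pos (lam.rowLen i) with h0 | h0
  · have : colBeyond γ ρ i (ρ.rowLen i) = 0 := by
      rw [colBeyond, Finset.card_eq_zero, Finset.filter_eq_empty_iff]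
      rintro ⟨a, b⟩ hc ⟨_, ha⟩
      rw [mem_skewCells, h.rowLen_eq] at hc
      have := lam.rowLen_anti i a ha.le
      omega
    omega
  · have h2 := h.hook_le (i, ρ.rowLen i) (mem_skewCells.2 ⟨le_rfl, by rw [h.rowLen_eq]; omega⟩)
    rw [hookLen_eq, h.rowLen_eq, max_self] at h2
    omega

/-- A partition has at most one `k`-skew diagram. -/
theorem IsKSkew.unique {k : ℕ} {lam γ ρ γ' ρ' : YoungDiagram}
    (h : IsKSkew k lam γ ρ) (h' : IsKSkew k lam γ' ρ') : γ = γ' ∧ ρ = ρ' := by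
  have key : ∀ d i, max (ρ.colLen 0) (ρ'.colLen 0) ≤ i + d → ρ.rowLen i = ρ'.rowLen i := by
    intro d
    induction d with
    | zero =>
      intro i hi
      rw [rowLen_eq_zero ρ (by omega), rowLen_eq_zero ρ' (by omega)]
    | succ d ih =>
      intro i hi
      exact le_antisymm (h'.rowLen_le h i fun a ha => (ih a (by omega)).symm)
        (h.rowLen_le h' i fun a ha => ih a (by omega))
  have e : ∀ i, ρ.rowLen i = ρ'.rowLen i := fun i => key _ i (Nat.le_add_left _ i)
  exact ⟨eq_of_rowLen fun i => by rw [h.rowLen_eq, h'.rowLen_eq, e], eq_of_rowLen e⟩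

/-- The Young diagram with `L` rows, of lengths `f 0 ≥ f 1 ≥ …`. -/
def ofFun (L : ℕ) (f : ℕ → ℕ) (hf : Antitone f) : YoungDiagram where
  cells := (Finset.range L ×ˢ Finset.range (f 0)).filter fun c => c.2 < f c.1
  isLowerSet := by
    rintro ⟨a, b⟩ ⟨c, d⟩ ⟨h1, h2⟩ h
    simp only [Finset.coe_filter, Finset.mem_product, Finset.mem_range, Set.mem_ofPred_eq] at *
    have := hf h1
    omega

theorem rowLen_ofFun (L : ℕ) (f : ℕ → ℕ) (hf : Antitone f) (i : ℕ) :
    (ofFun L f hf).rowLen i = if i < L then f i else 0 := by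
  have key : ∀ j, j < (ofFun L f hf).rowLen i ↔ i < L ∧ j < f i := by
    intro j
    rw [← YoungDiagram.mem_iff_lt_rowLen, ← YoungDiagram.mem_cells]
    simp only [ofFun, Finset.mem_filter, Finset.mem_product, Finset.mem_range]
    have := hf (Nat.zero_le i)
    omega
  apply le_antisymm
  · by_contra hlt
    have := (key _).1 (not_le.1 hlt)
    simp [this.1] at this
  · by_contra hlt
    rw [not_le] at hlt
    split_ifs at hlt with hL
    · exact lt_irrefl _ ((key _).2 ⟨hL, hlt⟩)
    · omega

/-- The heights of the columns after the rows of lengths `a 0 ≤ a 1 ≤ …` have been placed one after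
the other, each as far to the left as `k` allows. -/
noncomputable def buildCol (k : ℕ) (a : ℕ → ℕ) : ℕ → ℕ → ℕ
  | 0 => fun _ => 0
  | t + 1 => fun j => buildCol k a t j +
      if sInf {j | a t + buildCol k a t j ≤ k} ≤ j ∧
        j < sInf {j | a t + buildCol k a t j ≤ k} + a t then 1 else 0

/-- The first column of the row of length `a t` in that construction. -/
noncomputable def buildStart (k : ℕ) (a : ℕ → ℕ) (t : ℕ) : ℕ :=
  sInf {j | a t + buildCol k a t j ≤ k}

theorem buildCol_succ (k : ℕ) (a : ℕ → ℕ) (t j : ℕ) : buildCol k a (t + 1) j =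
    buildCol k a t j + if buildStart k a t ≤ j ∧ j < buildStart k a t + a t then 1 else 0 := rfl

theorem exists_buildCol_eq_zero (k : ℕ) (a : ℕ → ℕ) (t : ℕ) :
    ∃ N, ∀ j, N ≤ j → buildCol k a t j = 0 := by
  induction t with
  | zero => exact ⟨0, fun _ _ => rfl⟩
  | succ t ih =>
    obtain ⟨N, hN⟩ := ih
    refine ⟨max N (buildStart k a t + a t), fun j hj => ?_⟩
    rw [buildCol_succ, hN j (by omega), if_neg (by omega)]

theorem buildStart_spec {k : ℕ} {a : ℕ → ℕ} (ha : ∀ t, a t ≤ k) (t : ℕ) :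
    a t + buildCol k a t (buildStart k a t) ≤ k := by
  obtain ⟨N, hN⟩ := exists_buildCol_eq_zero k a t
  have hne : {j | a t + buildCol k a t j ≤ k}.Nonempty :=
    ⟨N, by simpa [hN N le_rfl] using ha t⟩
  exact Nat.sInf_mem hne

theorem lt_of_lt_buildStart {k : ℕ} {a : ℕ → ℕ} {t j : ℕ} (h : j < buildStart k a t) :
    k < a t + buildCol k a t j := by
  have := Nat.notMem_of_lt_sInf h
  simpa using this

theorem buildCol_antitone {k : ℕ} {a : ℕ → ℕ} (ha : ∀ t, a t ≤ k) (t : ℕ) :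
    Antitone (buildCol k a t) := by
  induction t with
  | zero => exact fun _ _ _ => le_rfl
  | succ t ih =>
    intro x y hxy
    rw [buildCol_succ, buildCol_succ]
    have h1 := ih hxy
    by_cases hy : buildStart k a t ≤ y ∧ y < buildStart k a t + a t
    · by_cases hx : buildStart k a t ≤ x ∧ x < buildStart k a t + a t
      · rw [if_pos hx, if_pos hy]; omega
      · rw [if_pos hy, if_neg hx]
        have h2 : x < buildStart k a t := by omega
        have h3 := lt_of_lt_buildStart h2
        have h4 := buildStart_spec ha t
        have h5 := ih hy.1
        omega
    · rw [if_neg hy]; omega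

theorem buildStart_mono {k : ℕ} {a : ℕ → ℕ} (ha : ∀ t, a t ≤ k) (hm : Monotone a) :
    Monotone (buildStart k a) := by
  refine monotone_nat_of_le_succ fun t => ?_
  by_contra hlt
  rw [not_le] at hlt
  have h1 := lt_of_lt_buildStart hlt
  have h2 := buildStart_spec ha (t + 1)
  rw [buildCol_succ] at h2
  have : a t ≤ a (t + 1) := hm (Nat.le_succ t)
  omega

theorem buildCol_eq_card (k : ℕ) (a : ℕ → ℕ) (t j : ℕ) : buildCol k a t j =
    ((Finset.range t).filter fun s =>
      buildStart k a s ≤ j ∧ j < buildStart k a s + a s).card := by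
  induction t with
  | zero => simp [buildCol]
  | succ t ih =>
    rw [buildCol_succ, ih, Finset.range_add_one, Finset.filter_insert]
    split_ifs <;> simp

/-- Every `k`-bounded partition has a `k`-skew diagram, and the columns of that diagram form a
`k`-bounded partition. -/
theorem exists_isKSkew {k : ℕ} {lam : YoungDiagram} (hlam : IsBounded k lam) :
    ∃ γ ρ ν, IsKSkew k lam γ ρ ∧ (∀ j, ν.rowLen j = skewCol γ ρ j) ∧ IsBounded k ν := by
  set L := lam.colLen 0 with hL
  set a : ℕ → ℕ := fun t => lam.rowLen (L - 1 - t) with ha_def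
  have hmono : Monotone a := fun s t h => lam.rowLen_anti _ _ (by omega)
  have hak : ∀ t, a t ≤ k := fun t => (lam.rowLen_anti 0 _ (Nat.zero_le _)).trans hlam
  have hρ : Antitone fun i => buildStart k a (L - 1 - i) :=
    fun i j h => buildStart_mono hak hmono (by omega)
  have hγ : Antitone fun i => buildStart k a (L - 1 - i) + a (L - 1 - i) :=
    fun i j h => add_le_add (buildStart_mono hak hmono (by omega)) (hmono (by omega))
  set ρ := ofFun L _ hρ with hρd
  set γ := ofFun L _ hγ with hγd
  have rρ : ∀ i, ρ.rowLen i = if i < L then buildStart k a (L - 1 - i) else 0 :=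
    rowLen_ofFun L _ hρ
  have rγ : ∀ i, γ.rowLen i = if i < L then buildStart k a (L - 1 - i) + a (L - 1 - i) else 0 :=
    rowLen_ofFun L _ hγ
  have hcard : ∀ (i t j : ℕ), t ≤ L → i + t = L →
      ((skewCells γ ρ).filter fun c => c.2 = j ∧ i ≤ c.1).card = buildCol k a t j := by
    intro i t j ht hit
    rw [buildCol_eq_card]
    refine Finset.card_bij' (fun c _ => L - 1 - c.1) (fun s _ => (L - 1 - s, j)) ?_ ?_ ?_ ?_
    · rintro ⟨x, y⟩ hc
      simp only [Finset.mem_filter, mem_skewCells, rρ, rγ] at hc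
      obtain ⟨⟨h1, h2⟩, rfl, h3⟩ := hc
      split_ifs at h1 h2 with hx
      · simp only [Finset.mem_filter, Finset.mem_range]
        exact ⟨by omega, h1, h2⟩
      · omega
    · intro s hs
      simp only [Finset.mem_filter, Finset.mem_range] at hs
      have e : L - 1 - (L - 1 - s) = s := by omega
      have e' : L - 1 - s < L := by omega
      simp only [Finset.mem_filter, mem_skewCells, rρ, rγ, e, if_pos e']
      exact ⟨hs.2, trivial, by omega⟩
    · rintro ⟨x, y⟩ hc
      simp only [Finset.mem_filter, mem_skewCells, rρ, rγ] at hc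
      obtain ⟨⟨h1, h2⟩, rfl, h3⟩ := hc
      split_ifs at h1 h2 with hx
      · simp only [Prod.mk.injEq, and_true]; omega
      · omega
    · intro s hs
      simp only [Finset.mem_filter, Finset.mem_range] at hs
      show L - 1 - (L - 1 - s) = s
      omega
  have hbeyond : ∀ i j, i < L → colBeyond γ ρ i j = buildCol k a (L - 1 - i) j := by
    intro i j hi
    rw [← hcard (i + 1) (L - 1 - i) j (by omega) (by omega)]
    rfl
  have hcolL : ∀ j, skewCol γ ρ j = buildCol k a L j := by
    intro j
    rw [← hcard 0 L j le_rfl (by omega)]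
    simp [skewCol]
  obtain ⟨N, hN⟩ := exists_buildCol_eq_zero k a L
  refine ⟨γ, ρ, ofFun N _ (buildCol_antitone hak L), ⟨?_, ?_, ?_, ?_⟩, ?_, ?_⟩
  · rintro ⟨i, j⟩ h
    rw [YoungDiagram.mem_iff_lt_rowLen, rρ] at h
    rw [YoungDiagram.mem_iff_lt_rowLen, rγ]
    split_ifs at h ⊢ <;> omega
  · intro i
    rw [skewRow_eq, rρ, rγ]
    split_ifs with hi
    · have e : L - 1 - (L - 1 - i) = i := by omega
      simp [ha_def, e]
    · rw [rowLen_eq_zero lam (by omega)]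
  · rintro ⟨i, j⟩ h
    rw [mem_skewCells] at h
    have hi : i < L := by
      by_contra hi
      have := h.2
      rw [rγ, if_neg hi] at this
      omega
    rw [hookLen_eq, hbeyond i j hi]
    rw [rρ, rγ, if_pos hi, if_pos hi] at *
    have h1 := buildStart_spec hak (L - 1 - i)
    have h2 := buildCol_antitone hak (L - 1 - i) h.1
    omega
  · rintro ⟨i, j⟩ h
    rw [YoungDiagram.mem_iff_lt_rowLen] at h
    have hi : i < L := by
      by_contra hi
      rw [rρ, if_neg hi] at h
      omega
    rw [hookLen_eq, hbeyond i j hi]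
    rw [rρ, if_pos hi] at *
    rw [rγ, if_pos hi]
    have h1 := lt_of_lt_buildStart h
    omega
  · intro j
    rw [rowLen_ofFun, hcolL]
    split_ifs with h
    · rfl
    · rw [hN j (by omega)]
  · have hle : ∀ t, buildCol k a t 0 ≤ k := by
      intro t
      induction t with
      | zero => simp [buildCol]
      | succ t ih =>
        rw [buildCol_succ]
        split_ifs with h
        · have h1 := buildStart_spec hak t
          have h2 : buildStart k a t = 0 := by omega
          rw [h2] at h1
          omega
        · omega
    rw [IsBounded, rowLen_ofFun]
    split_ifs
    · exact hle L
    · omega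

theorem IsKConj.unique {k : ℕ} {lam ν ν' : YoungDiagram} (h : IsKConj k lam ν)
    (h' : IsKConj k lam ν') : ν = ν' := by
  obtain ⟨γ, ρ, h1, h2⟩ := h
  obtain ⟨γ', ρ', h1', h2'⟩ := h'
  obtain ⟨rfl, rfl⟩ := h1.unique h1'
  exact eq_of_rowLen fun j => by rw [h2, h2']

theorem exists_isKConj {k : ℕ} {lam : YoungDiagram} (h : IsBounded k lam) :
    ∃ ν, IsKConj k lam ν ∧ IsBounded k ν := by
  obtain ⟨γ, ρ, ν, h1, h2, h3⟩ := exists_isKSkew h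
  exact ⟨ν, ⟨γ, ρ, h1, h2⟩, h3⟩

/-! ### The `k`-Young lattice -/

/-- The set of `k`-bounded partitions, to be ordered by the `k`-order (not by containment). -/
structure Poset (k : ℕ) where
  shape : YoungDiagram
  bounded : IsBounded k shape

/-- The degree `|lam|` of a `k`-bounded partition. -/
def Poset.degree {k : ℕ} (lam : Poset k) : ℕ := lam.shape.card

/-- The `k`-conjugate, as a map from `k`-bounded partitions to `k`-bounded partitions. -/
noncomputable def kConj {k : ℕ} (lam : Poset k) : Poset k :=
  ⟨(exists_isKConj lam.bounded).choose, (exists_isKConj lam.bounded).choose_spec.2⟩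

theorem kConj_spec {k : ℕ} (lam : Poset k) : IsKConj k lam.shape (kConj lam).shape :=
  (exists_isKConj lam.bounded).choose_spec.1

/-- The covering relation of the `k`-order: `lam ⊆ μ`, the `k`-conjugate of `lam` is contained in
that of `μ`, and `|μ| - |lam| = 1`. -/
def Covers {k : ℕ} (lam μ : Poset k) : Prop :=
  lam.shape ≤ μ.shape ∧ (kConj lam).shape ≤ (kConj μ).shape ∧ μ.degree = lam.degree + 1

theorem degree_le {k : ℕ} {lam μ : Poset k} (h : Relation.ReflTransGen Covers lam μ) :
    lam = μ ∨ lam.degree < μ.degree := by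
  induction h with
  | refl => exact Or.inl rfl
  | tail _ h2 ih =>
    have := h2.2.2
    rcases ih with rfl | ih
    · right; omega
    · right; omega

/-- The `k`-Young lattice: the `k`-bounded partitions, ordered by the reflexive transitive closure
of the covering relation. -/
instance instPartialOrderPoset (k : ℕ) : PartialOrder (Poset k) where
  le := Relation.ReflTransGen Covers
  le_refl _ := Relation.ReflTransGen.refl
  le_trans _ _ _ := Relation.ReflTransGen.trans
  le_antisymm a b h1 h2 := by
    rcases degree_le h1 with h | h
    · exact h
    · rcases degree_le h2 with h' | h'
      · exact h'.symm
      · omega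

theorem shape_le {k : ℕ} {lam μ : Poset k} (h : lam ≤ μ) : lam.shape ≤ μ.shape := by
  have h' : Relation.ReflTransGen Covers lam μ := h
  induction h' with
  | refl => exact le_rfl
  | tail h1 h2 ih => exact (ih h1).trans h2.1

/-- The rectangular partition `(m^n)`, with `n` parts equal to `m`. -/
def rect (m n : ℕ) : YoungDiagram := ofFun n (fun _ => m) antitone_const

theorem rect_bounded {k m : ℕ} (h : m ≤ k) (n : ℕ) : IsBounded k (rect m n) := by
  rw [IsBounded, rect, rowLen_ofFun]
  split_ifs <;> omega

/-- The partition `(m^n)` as an element of the `k`-Young lattice, for `m ≤ k`. -/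
def kRect {k m : ℕ} (h : m ≤ k) (n : ℕ) : Poset k := ⟨rect m n, rect_bounded h n⟩

/-- `L^k(m,n)`: the principal order ideal of the `k`-Young lattice generated by `(m^n)`, as a poset
with the order of the `k`-Young lattice. -/
abbrev Ideal {k m : ℕ} (h : m ≤ k) (n : ℕ) : Type := Set.Iic (kRect h n)

instance instFiniteIdeal {k m : ℕ} (h : m ≤ k) (n : ℕ) : Finite (Ideal h n) := by
  refine Finite.of_injective
    (fun x : Ideal h n => (⟨x.1.shape.cells, Finset.mem_powerset.2
      (YoungDiagram.cells_subset_iff.2 (shape_le x.2))⟩ : (rect m n).cells.powerset)) ?_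
  rintro ⟨⟨s, hs⟩, hx⟩ ⟨⟨t, ht⟩, hy⟩ hxy
  have : s.cells = t.cells := congrArg Subtype.val hxy
  have : s = t := YoungDiagram.ext this
  subst this
  rfl

noncomputable instance instFintypeIdeal {k m : ℕ} (h : m ≤ k) (n : ℕ) : Fintype (Ideal h n) :=
  Fintype.ofFinite _

/-! ### Generating functions -/

/-- The rank of an element of a finite poset: the maximal length `r` of a chain
`x₀ < x₁ < ⋯ < x_r = x`. -/
noncomputable def rank {α : Type*} [PartialOrder α] [Finite α] (x : α) : ℕ :=
  (Order.height x).toNat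

/-- The rank-generating function of a finite poset, a polynomial in `q`. -/
noncomputable def rankGen (α : Type*) [PartialOrder α] [Fintype α] : Polynomial ℚ :=
  ∑ x : α, Polynomial.X ^ rank x

/-- The `q`-binomial coefficient `∏_{i=1}^{b} (1 - q^{a-b+i}) / ∏_{i=1}^{b} (1 - q^i)` in the field
of rational functions in `q`, with the factors of the numerator in decreasing order
(`1 - q^a`, …, `1 - q^{a-b+1}`). -/
noncomputable def qBinom (a b : ℕ) : RatFunc ℚ :=
  (∏ i ∈ Finset.range b, (1 - RatFunc.X ^ (a - i))) /
    ∏ i ∈ Finset.range b, (1 - RatFunc.X ^ (i + 1))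

end KYoung

/-! Put `K = k + 1 - m`. The order ideal generated by `(m^n)` consists of the partitions inside the
rectangle that have at most `K` nonempty rows shorter than `m` (`le_kRect_iff`); the ranks and the
generating function are read off from this description.

The `k`-skew diagram of such a partition is explicit (`exists_isKSkew_stack`): every row starts
exactly where the `K`-th row after it ends. A column therefore meets at most one row of each residue
class of row indices modulo `K`, and its height is the number of classes that reach it
(`card_stack`). The lengths of the classes grow with the rows, so inside this family containment of
partitions implies containment of the `k`-conjugates (`kConj_le_kConj_of_stack`), provided the
classes are indexed from a common last row, which may be empty. Hence adding a cell to the first row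
shorter than `m` gives an upper cover in the family (`exists_covers_of_ne_rect`), and chains of such
covers end at `(m^n)`; removing the last cell of the last row gives a lower cover
(`exists_covers_of_nearRect`), so the rank is the degree. Conversely the family is closed under lower
covers: in its members all columns of the `k`-skew diagram have height at most `K`, while more than
`K` nonempty rows shorter than `m` all fit against the first column and make it higher than `K`
(`lt_rowLen_kConj`).

For the generating function, the members with at most `K` rows fill the box of width `m` and height
`K`, which the `q`-Pascal recursion identifies with a `q`-binomial coefficient (`genSum_X_box`). The
members with exactly `K + i` rows, `i ≥ 1`, have `i` rows equal to `m` and then `K` positive rows;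
without the first column of the latter these form a box of width `m - 1` and height `K`
(`genSum_nearRects_succ`). The number of elements is the same computation at `q = 1` in `ℕ`. -/

namespace KYoung

/-! ### Rows and cells of Young diagrams -/

theorem le_iff_rowLen_le {lam mu : YoungDiagram} :
    lam ≤ mu ↔ ∀ i, lam.rowLen i ≤ mu.rowLen i := by
  constructor
  · intro h i
    by_contra hlt
    exact lt_irrefl _ (YoungDiagram.mem_iff_lt_rowLen.1
      (h (YoungDiagram.mem_iff_lt_rowLen.2 (not_le.1 hlt))))
  · rintro h ⟨i, j⟩ hc
    rw [YoungDiagram.mem_iff_lt_rowLen] at hc ⊢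
    exact hc.trans_le (h i)

theorem rowLen_pos_iff {lam : YoungDiagram} {i : ℕ} : 0 < lam.rowLen i ↔ i < lam.colLen 0 := by
  rw [← YoungDiagram.mem_iff_lt_rowLen, YoungDiagram.mem_iff_lt_colLen]

theorem rowLen_rect (m n i : ℕ) : (rect m n).rowLen i = if i < n then m else 0 :=
  rowLen_ofFun n _ antitone_const i

theorem le_rect_iff {lam : YoungDiagram} {m n : ℕ} :
    lam ≤ rect m n ↔ ∀ i, lam.rowLen i ≤ if i < n then m else 0 := by
  simp only [le_iff_rowLen_le, rowLen_rect]

theorem card_eq_sum_rowLen (lam : YoungDiagram) {N : ℕ} (h : ∀ i, N ≤ i → lam.rowLen i = 0) :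
    lam.card = ∑ i ∈ Finset.range N, lam.rowLen i := by
  rw [YoungDiagram.card, Finset.card_eq_sum_card_fiberwise (f := Prod.fst) (t := Finset.range N)]
  · exact Finset.sum_congr rfl fun i _ => (YoungDiagram.rowLen_eq_card lam).symm
  · rintro ⟨i, j⟩ hc
    have hc' : j < lam.rowLen i := YoungDiagram.mem_iff_lt_rowLen.1 hc
    rw [Finset.coe_range, Set.mem_Iio]
    by_contra hi
    rw [h i (not_lt.1 hi)] at hc'
    omega

theorem card_filter_skewCells {γ ρ : YoungDiagram} {N : ℕ}
    (h : ∀ i, N ≤ i → γ.rowLen i ≤ ρ.rowLen i)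
    (i j : ℕ) :
    ((skewCells γ ρ).filter fun c => c.2 = j ∧ i ≤ c.1).card =
      ((Finset.range N).filter fun a => i ≤ a ∧ ρ.rowLen a ≤ j ∧ j < γ.rowLen a).card := by
  refine Finset.card_bij' (fun c _ => c.1) (fun a _ => (a, j)) ?_ ?_ ?_ ?_
  · rintro ⟨x, y⟩ hc
    simp only [Finset.mem_filter, mem_skewCells, Finset.mem_range] at hc ⊢
    obtain ⟨⟨h1, h2⟩, rfl, h3⟩ := hc
    refine ⟨?_, h3, h1, h2⟩
    by_contra hx
    have := h x (not_lt.1 hx)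
    omega
  · intro a ha
    simp only [Finset.mem_filter, mem_skewCells, Finset.mem_range] at ha ⊢
    exact ⟨ha.2.2, trivial, ha.2.1⟩
  · rintro ⟨x, y⟩ hc
    simp only [Finset.mem_filter] at hc
    rw [hc.2.1]
  · intro a _
    rfl

/-! ### The `k`-skew diagram of a nearly rectangular partition -/

/-- For row lengths `a 0, a 1, …`, counted from the last row, the total length of the rows
`t - K, t - 2K, …`: the first column of row `t` when every row starts where the `K`-th row after
it ends. -/
def stackStart (K : ℕ) (a : ℕ → ℕ) (t : ℕ) : ℕ :=
  ∑ c ∈ Finset.range (t / K), a (t - (c + 1) * K)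

theorem stackStart_of_lt {K : ℕ} (a : ℕ → ℕ) {t : ℕ} (h : t < K) : stackStart K a t = 0 := by
  simp [stackStart, Nat.div_eq_of_lt h]

theorem stackStart_add {K : ℕ} (hK : 1 ≤ K) (a : ℕ → ℕ) (t : ℕ) :
    stackStart K a (t + K) = stackStart K a t + a t := by
  rw [stackStart, Nat.add_div_right t hK, Finset.sum_range_succ', stackStart]
  congr 1
  · refine Finset.sum_congr rfl fun c _ => ?_
    congr 1
    rw [add_mul (c + 1)]
    omega
  · simp

theorem stackStart_mono {K : ℕ} (hK : 1 ≤ K) {a : ℕ → ℕ} (ha : Monotone a) :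
    Monotone (stackStart K a) := by
  refine monotone_nat_of_le_succ fun t => ?_
  induction t using Nat.strong_induction_on with
  | _ t ih =>
    rcases lt_or_ge t K with h | h
    · rw [stackStart_of_lt a h]
      exact Nat.zero_le _
    · obtain ⟨u, rfl⟩ := Nat.exists_eq_add_of_le' h
      rw [show u + K + 1 = u + 1 + K by ring, stackStart_add hK, stackStart_add hK]
      exact add_le_add (ih u (by omega)) (ha (Nat.le_succ u))

theorem stackStart_le_stackStart (K : ℕ) {a b : ℕ → ℕ} (h : ∀ t, a t ≤ b t) (t : ℕ) :
    stackStart K a t ≤ stackStart K b t :=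
  Finset.sum_le_sum fun _ _ => h _

/-- The height of a column of the stack of rows. The rows of one residue class modulo `K` are laid
end to end, so column `j` meets a class exactly if `j` lies before the end of that class, and the
ends of the classes are the starting columns of the next `K` rows. -/
theorem card_stack {K : ℕ} (hK : 1 ≤ K) {a : ℕ → ℕ} (t j : ℕ) :
    ((Finset.range t).filter fun u => stackStart K a u ≤ j ∧ j < stackStart K a u + a u).card =
      ((Finset.Ico t (t + K)).filter fun u => j < stackStart K a u).card := by
  induction t with
  | zero =>
    rw [Finset.range_zero, Finset.filter_empty, Finset.card_empty, eq_comm, Finset.card_eq_zero,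
      Finset.filter_eq_empty_iff]
    intro u hu
    rw [Finset.mem_Ico] at hu
    rw [stackStart_of_lt a (by omega)]
    omega
  | succ t ih =>
    -- From `t` to `t + 1` the window of starting columns loses `t` and gains `t + K`, where row `t`
    -- ends; the difference counts whether row `t` meets column `j`.
    have h1 : ((Finset.Ico t (t + K + 1)).filter fun u => j < stackStart K a u).card =
        ((Finset.Ico t (t + K)).filter fun u => j < stackStart K a u).card +
          if j < stackStart K a (t + K) then 1 else 0 := by
      rw [← Finset.insert_Ico_right_eq_Ico_add_one (by omega), Finset.filter_insert]
      split_ifs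
      · rw [Finset.card_insert_of_notMem (by simp)]
      · rfl
    have h2 : ((Finset.Ico t (t + K + 1)).filter fun u => j < stackStart K a u).card =
        ((Finset.Ico (t + 1) (t + 1 + K)).filter fun u => j < stackStart K a u).card +
          if j < stackStart K a t then 1 else 0 := by
      rw [← Finset.insert_Ico_add_one_left_eq_Ico (by omega), Finset.filter_insert,
        show t + K + 1 = t + 1 + K by ring]
      split_ifs
      · rw [Finset.card_insert_of_notMem (by simp)]
      · rfl
    rw [Finset.range_add_one, Finset.filter_insert]
    rw [stackStart_add hK] at h1
    split_ifs at h1 h2 ⊢ <;> first | omega | (rw [Finset.card_insert_of_notMem (by simp)]; omega)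

/-- Row lengths counted from row `L - 1` upwards. For `t ≥ L` the truncated subtraction repeats row
`0`, which keeps the function monotone. -/
def revRow (lam : YoungDiagram) (L t : ℕ) : ℕ := lam.rowLen (L - 1 - t)

theorem revRow_mono (lam : YoungDiagram) (L : ℕ) : Monotone (revRow lam L) :=
  fun _ _ h => lam.rowLen_anti _ _ (by omega)

/-- If all rows are at most `m = k + 1 - K` long, and all but the last `K` of the rows
`0, …, L - 1` are equal to `m`, then in the `k`-skew diagram every row starts where the `K`-th row
after it ends. Some of the last rows may be empty. -/
theorem exists_isKSkew_stack {k m K L : ℕ} (hK : 1 ≤ K) (hmK : m + K = k + 1) {lam : YoungDiagram}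
    (hm : ∀ i, lam.rowLen i ≤ m) (hL : ∀ i, L ≤ i → lam.rowLen i = 0)
    (hfull : ∀ i, i + K < L → lam.rowLen i = m) :
    ∃ γ ρ, IsKSkew k lam γ ρ ∧ ∀ j, skewCol γ ρ j =
      ((Finset.Ico L (L + K)).filter fun u => j < stackStart K (revRow lam L) u).card := by
  set a := revRow lam L with ha
  set s := stackStart K a with hs
  have ham : Monotone a := revRow_mono lam L
  have hsm : Monotone s := stackStart_mono hK ham
  have hai : ∀ i, i < L → a (L - 1 - i) = lam.rowLen i := fun i hi => by
    rw [ha, revRow, show L - 1 - (L - 1 - i) = i by omega]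
  have hρ : Antitone fun i => s (L - 1 - i) := fun i j h => hsm (by omega)
  have hγ : Antitone fun i => s (L - 1 - i) + a (L - 1 - i) :=
    fun i j h => add_le_add (hsm (by omega)) (ham (by omega))
  set ρ := ofFun L _ hρ with hρd
  set γ := ofFun L _ hγ with hγd
  have rρ : ∀ i, ρ.rowLen i = if i < L then s (L - 1 - i) else 0 := rowLen_ofFun L _ hρ
  have rγ : ∀ i, γ.rowLen i = if i < L then s (L - 1 - i) + a (L - 1 - i) else 0 :=
    rowLen_ofFun L _ hγ
  have hcol : ∀ i t j, i + t = L →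
      ((skewCells γ ρ).filter fun c => c.2 = j ∧ i ≤ c.1).card =
        ((Finset.Ico t (t + K)).filter fun u => j < s u).card := by
    intro i t j hit
    rw [card_filter_skewCells (N := L) (fun i hi => by rw [rγ, if_neg (by omega)]; omega),
      ← card_stack hK]
    refine Finset.card_bij' (fun c _ => L - 1 - c) (fun c _ => L - 1 - c) ?_ ?_ ?_ ?_
    · intro c hc
      simp only [Finset.mem_filter, Finset.mem_range, rρ, rγ] at hc ⊢
      rw [if_pos hc.1, if_pos hc.1] at hc
      exact ⟨by omega, hc.2.2⟩
    · intro c hc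
      simp only [Finset.mem_filter, Finset.mem_range, rρ, rγ] at hc ⊢
      have e : L - 1 - (L - 1 - c) = c := by omega
      rw [if_pos (by omega), if_pos (by omega), e]
      exact ⟨by omega, by omega, hc.2⟩
    · intro c hc
      simp only [Finset.mem_filter, Finset.mem_range] at hc
      omega
    · intro c hc
      simp only [Finset.mem_filter, Finset.mem_range] at hc
      omega
  have hbeyond : ∀ i j, i < L → colBeyond γ ρ i j =
      ((Finset.Ico (L - 1 - i) (L - 1 - i + K)).filter fun u => j < s u).card :=
    fun i j hi => hcol (i + 1) (L - 1 - i) j (by omega)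
  refine ⟨γ, ρ, ⟨?_, ?_, ?_, ?_⟩, ?_⟩
  · rw [le_iff_rowLen_le]
    intro i
    rw [rρ, rγ]
    split_ifs <;> omega
  · intro i
    rw [skewRow_eq, rρ, rγ]
    split_ifs with hi
    · rw [hai i hi]; omega
    · rw [hL i (by omega)]
  · rintro ⟨i, j⟩ h
    rw [mem_skewCells, rρ, rγ] at h
    split_ifs at h with hi
    · rw [hookLen_eq, hbeyond i j hi, rρ, rγ, if_pos hi, if_pos hi]
      -- Row `i` itself is not counted among the next `K` rows, since it starts weakly before `j`.
      have hlt : ((Finset.Ico (L - 1 - i) (L - 1 - i + K)).filter fun u => j < s u).card < K := by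
        calc _ < (Finset.Ico (L - 1 - i) (L - 1 - i + K)).card :=
              Finset.card_lt_card (Finset.filter_ssubset.2
                ⟨L - 1 - i, Finset.mem_Ico.2 (by omega), by omega⟩)
          _ = K := by simp
      have := hm i
      rw [hai i hi] at *
      omega
    · omega
  · rintro ⟨i, j⟩ h
    rw [YoungDiagram.mem_iff_lt_rowLen, rρ] at h
    split_ifs at h with hi
    · rw [hookLen_eq, hbeyond i j hi, rρ, rγ, if_pos hi, if_pos hi]
      have hall : ((Finset.Ico (L - 1 - i) (L - 1 - i + K)).filter fun u => j < s u).card = K := by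
        rw [Finset.filter_true_of_mem]
        · simp
        · intro u hu
          exact h.trans_le (hsm (Finset.mem_Ico.1 hu).1)
      -- A row that does not start in the first column has `K` rows after it, hence is full.
      have hfi : lam.rowLen i = m := by
        refine hfull i ?_
        by_contra hlt
        rw [hs, stackStart_of_lt a (by omega)] at h
        omega
      rw [hai i hi]
      omega
    · omega
  · intro j
    rw [← hcol 0 L j (by omega), skewCol]
    simp

/-- The columns of the `k`-skew diagram of a partition as in `exists_isKSkew_stack`. -/
theorem rowLen_kConj_stack {k m K L : ℕ} (hK : 1 ≤ K) (hmK : m + K = k + 1) {lam : Poset k}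
    (hm : ∀ i, lam.shape.rowLen i ≤ m) (hL : ∀ i, L ≤ i → lam.shape.rowLen i = 0)
    (hfull : ∀ i, i + K < L → lam.shape.rowLen i = m) (j : ℕ) :
    (kConj lam).shape.rowLen j =
      ((Finset.Ico L (L + K)).filter fun u => j < stackStart K (revRow lam.shape L) u).card := by
  obtain ⟨γ, ρ, h, hc⟩ := exists_isKSkew_stack hK hmK hm hL hfull
  obtain ⟨γ', ρ', h', hc'⟩ := kConj_spec lam
  obtain ⟨rfl, rfl⟩ := h.unique h'
  rw [hc', hc]

/-- `k`-conjugation preserves containment between partitions of width at most `m = k + 1 - K` with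
at most `L` rows, all but the last `K` of them equal to `m`. -/
theorem kConj_le_kConj_of_stack {k m K L : ℕ} (hK : 1 ≤ K) (hmK : m + K = k + 1) {lam mu : Poset k}
    (hle : lam.shape ≤ mu.shape) (hm : ∀ i, mu.shape.rowLen i ≤ m)
    (hL : ∀ i, L ≤ i → mu.shape.rowLen i = 0)
    (hfull : ∀ i, i + K < L → lam.shape.rowLen i = m) :
    (kConj lam).shape ≤ (kConj mu).shape := by
  rw [le_iff_rowLen_le] at hle ⊢
  intro j
  rw [rowLen_kConj_stack hK hmK (fun i => (hle i).trans (hm i))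
      (fun i hi => Nat.le_zero.1 (hL i hi ▸ hle i)) hfull,
    rowLen_kConj_stack hK hmK hm hL (fun i hi => le_antisymm (hm i) (hfull i hi ▸ hle i))]
  exact Finset.card_le_card (Finset.monotone_filter_right _ fun u _ hu =>
    lt_of_lt_of_le hu (stackStart_le_stackStart K (fun t => hle _) u))

/-! ### The order ideal generated by a rectangle -/

/-- At most `K` nonempty rows are shorter than `m`. (In the partitions considered no row is longer
than `m`, so the condition says that a row is equal to `m` if the `K`-th row after it is
nonempty.) -/
def NearRect (m K : ℕ) (lam : YoungDiagram) : Prop :=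
  ∀ i, 0 < lam.rowLen (i + K) → lam.rowLen i = m

theorem exists_rowLen_eq {f : ℕ → ℕ} (hf : Antitone f) {N : ℕ} (hN : ∀ i, N ≤ i → f i = 0) :
    ∃ lam : YoungDiagram, ∀ i, lam.rowLen i = f i := by
  refine ⟨ofFun N f hf, fun i => ?_⟩
  rw [rowLen_ofFun]
  split_ifs with h
  · rfl
  · rw [hN i (not_lt.1 h)]

theorem exists_remove_cell {lam : YoungDiagram} {i : ℕ}
    (h : lam.rowLen (i + 1) < lam.rowLen i) :
    ∃ mu : YoungDiagram, mu.rowLen i + 1 = lam.rowLen i ∧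
      (∀ a, a ≠ i → mu.rowLen a = lam.rowLen a) ∧ lam.card = mu.card + 1 := by
  have hf : Antitone fun a => if a = i then lam.rowLen i - 1 else lam.rowLen a := by
    refine antitone_nat_of_succ_le fun a => ?_
    have h1 := lam.rowLen_anti a (a + 1) (Nat.le_succ a)
    split_ifs with h2 h3 h3
    · omega
    · subst h2; omega
    · subst h3; omega
    · exact h1
  have hz : ∀ a, lam.colLen 0 ≤ a → lam.rowLen a = 0 := fun a ha => rowLen_eq_zero lam ha
  have hi : i < lam.colLen 0 := rowLen_pos_iff.1 (by omega)
  obtain ⟨mu, hmu⟩ := exists_rowLen_eq hf (N := lam.colLen 0) fun a ha => by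
    rw [if_neg (by omega), hz a ha]
  have h1 : mu.rowLen i + 1 = lam.rowLen i := by rw [hmu, if_pos rfl]; omega
  have h2 : ∀ a, a ≠ i → mu.rowLen a = lam.rowLen a := fun a ha => by rw [hmu, if_neg ha]
  refine ⟨mu, h1, h2, ?_⟩
  rw [card_eq_sum_rowLen lam hz, card_eq_sum_rowLen mu (N := lam.colLen 0) fun a ha => by
      rw [h2 a (by omega), hz a ha],
    ← Finset.add_sum_erase _ _ (Finset.mem_range.2 hi),
    ← Finset.add_sum_erase _ _ (Finset.mem_range.2 hi), ← h1,
    Finset.sum_congr rfl fun a ha => h2 a (Finset.ne_of_mem_erase ha)]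
  ring

theorem exists_add_cell {lam : YoungDiagram} {i : ℕ}
    (h : ∀ a, a < i → lam.rowLen i < lam.rowLen a) :
    ∃ mu : YoungDiagram, mu.rowLen i = lam.rowLen i + 1 ∧
      (∀ a, a ≠ i → mu.rowLen a = lam.rowLen a) ∧ mu.card = lam.card + 1 := by
  have hf : Antitone fun a => if a = i then lam.rowLen i + 1 else lam.rowLen a := by
    refine antitone_nat_of_succ_le fun a => ?_
    have h1 := lam.rowLen_anti a (a + 1) (Nat.le_succ a)
    split_ifs with h2 h3 h3
    · omega
    · have := h a (by omega); omega
    · subst h3; omega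
    · exact h1
  have hz : ∀ a, lam.colLen 0 + i + 1 ≤ a → lam.rowLen a = 0 :=
    fun a ha => rowLen_eq_zero lam (by omega)
  obtain ⟨mu, hmu⟩ := exists_rowLen_eq hf (N := lam.colLen 0 + i + 1) fun a ha => by
    rw [if_neg (by omega), hz a ha]
  have h1 : mu.rowLen i = lam.rowLen i + 1 := by rw [hmu, if_pos rfl]
  have h2 : ∀ a, a ≠ i → mu.rowLen a = lam.rowLen a := fun a ha => by rw [hmu, if_neg ha]
  have hi : i < lam.colLen 0 + i + 1 := by omega
  refine ⟨mu, h1, h2, ?_⟩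
  rw [card_eq_sum_rowLen lam hz, card_eq_sum_rowLen mu (N := lam.colLen 0 + i + 1) fun a ha => by
      rw [h2 a (by omega), hz a ha],
    ← Finset.add_sum_erase _ _ (Finset.mem_range.2 hi),
    ← Finset.add_sum_erase _ _ (Finset.mem_range.2 hi), h1,
    Finset.sum_congr rfl fun a ha => h2 a (Finset.ne_of_mem_erase ha)]
  ring

/-- Removing the last cell of the last row gives a lower cover. -/
theorem exists_covers_of_nearRect {k m K : ℕ} (hK : 1 ≤ K) (hmK : m + K = k + 1) {lam : Poset k}
    (hm : ∀ i, lam.shape.rowLen i ≤ m) (hlam : NearRect m K lam.shape) (h0 : lam.degree ≠ 0) :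
    ∃ mu : Poset k, Covers mu lam := by
  set L := lam.shape.colLen 0 with hL
  have hz : ∀ i, L ≤ i → lam.shape.rowLen i = 0 := fun i hi => rowLen_eq_zero _ hi
  have hpos : 0 < L := by
    by_contra hn
    refine h0 ?_
    rw [Poset.degree, card_eq_sum_rowLen _ hz, Nat.eq_zero_of_not_pos hn, Finset.sum_range_zero]
  have hlast : lam.shape.rowLen (L - 1 + 1) < lam.shape.rowLen (L - 1) := by
    rw [hz _ (by omega)]
    exact rowLen_pos_iff.2 (by omega)
  obtain ⟨mu, h1, h2, h3⟩ := exists_remove_cell hlast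
  have hle : mu ≤ lam.shape := by
    rw [le_iff_rowLen_le]
    intro i
    by_cases hi : i = L - 1
    · subst hi; omega
    · rw [h2 i hi]
  refine ⟨⟨mu, (le_iff_rowLen_le.1 hle 0).trans lam.bounded⟩, hle, ?_, h3⟩
  refine kConj_le_kConj_of_stack (L := L) hK hmK hle hm hz fun i hi => ?_
  change mu.rowLen i = m
  rw [h2 i (by omega), hlam i (rowLen_pos_iff.2 hi)]

/-- Adding a cell to the first row shorter than `m` gives an upper cover. -/
theorem exists_covers_of_ne_rect {k m K n : ℕ} (hK : 1 ≤ K) (hmK : m + K = k + 1) {lam : Poset k}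
    (hle : lam.shape ≤ rect m n) (hlam : NearRect m K lam.shape) (hne : lam.shape ≠ rect m n) :
    ∃ mu : Poset k, Covers lam mu ∧ mu.shape ≤ rect m n ∧ NearRect m K mu.shape := by
  rw [le_rect_iff] at hle
  have hex : ∃ i, i < n ∧ lam.shape.rowLen i < m := by
    by_contra! hall
    refine hne (eq_of_rowLen fun i => ?_)
    have h1 := hle i
    have h2 := hall i
    rw [rowLen_rect]
    split_ifs at h1 ⊢ with hi
    · exact le_antisymm h1 (h2 hi)
    · omega
  classical
  obtain ⟨hin, him⟩ := Nat.find_spec hex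
  set i := Nat.find hex with hi
  have hbefore : ∀ a, a < i → lam.shape.rowLen a = m := fun a ha => by
    have h1 := Nat.find_min hex ha
    have h2 := hle a
    rw [if_pos (by omega)] at h2
    by_contra hc
    exact h1 ⟨by omega, by omega⟩
  have hz : ∀ a, i + K ≤ a → lam.shape.rowLen a = 0 := fun a ha => by
    by_contra hc
    have h1 := lam.shape.rowLen_anti _ _ ha
    have h2 := hlam i (by omega)
    omega
  obtain ⟨mu, h1, h2, h3⟩ := exists_add_cell (lam := lam.shape) (i := i)
    fun a ha => by rw [hbefore a ha]; exact him
  have hsub : lam.shape ≤ mu := by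
    rw [le_iff_rowLen_le]
    intro a
    by_cases ha : a = i
    · subst ha; omega
    · rw [h2 a ha]
  have hmu : ∀ a, mu.rowLen a ≤ if a < n then m else 0 := fun a => by
    by_cases ha : a = i
    · rw [ha, if_pos hin]; omega
    · rw [h2 a ha]; exact hle a
  have hmu' : ∀ a, mu.rowLen a ≤ m := fun a => (hmu a).trans (by split_ifs <;> omega)
  have hzmu : ∀ a, i + K ≤ a → mu.rowLen a = 0 := fun a ha => by
    rw [h2 a (by omega), hz a ha]
  refine ⟨⟨mu, (hmu' 0).trans (by omega)⟩, ⟨hsub, ?_, h3⟩, le_rect_iff.2 hmu, fun a ha => ?_⟩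
  · exact kConj_le_kConj_of_stack (L := i + K) hK hmK hsub hmu' hzmu
      fun a ha => hbefore a (by omega)
  · have hai : a < i := by
      by_contra hc
      have := hzmu (a + K) (by omega)
      change 0 < mu.rowLen (a + K) at ha
      omega
    change mu.rowLen a = m
    rw [h2 a (by omega), hbefore a hai]

theorem rowLen_kConj_le_of_nearRect {k m K : ℕ} (hK : 1 ≤ K) (hmK : m + K = k + 1) {lam : Poset k}
    (hm : ∀ i, lam.shape.rowLen i ≤ m) (hlam : NearRect m K lam.shape) (j : ℕ) :
    (kConj lam).shape.rowLen j ≤ K := by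
  rw [rowLen_kConj_stack (L := lam.shape.colLen 0) hK hmK hm (fun i hi => rowLen_eq_zero _ hi)
    fun i hi => hlam i (rowLen_pos_iff.2 hi)]
  exact (Finset.card_filter_le _ _).trans (by simp)

/-- If more than `K` nonempty rows are shorter than `m = k + 1 - K`, then the last `K + 1` rows of
the `k`-skew diagram all start in its first column. -/
theorem lt_rowLen_kConj {k m K : ℕ} (hmK : m + K = k + 1) {mu : Poset k} {i : ℕ}
    (h1 : mu.shape.rowLen i < m) (h2 : 0 < mu.shape.rowLen (i + K)) :
    K < (kConj mu).shape.rowLen 0 := by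
  obtain ⟨γ, ρ, h, hc⟩ := kConj_spec mu
  have hr := h.rowLen_eq
  set L := mu.shape.colLen 0 with hL
  have hiL : i + K < L := rowLen_pos_iff.1 h2
  have hcell : ∀ a, L ≤ a → γ.rowLen a ≤ ρ.rowLen a := fun a ha => by
    rw [hr, rowLen_eq_zero _ ha, add_zero]
  have hi : mu.shape.rowLen (L - 1 - K) < m :=
    (mu.shape.rowLen_anti i _ (by omega)).trans_lt h1
  have hbeyond : colBeyond γ ρ (L - 1 - K) 0 ≤ K := by
    have e : colBeyond γ ρ (L - 1 - K) 0 =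
        ((skewCells γ ρ).filter fun c => c.2 = 0 ∧ L - 1 - K + 1 ≤ c.1).card := rfl
    rw [e, card_filter_skewCells hcell]
    calc _ ≤ (Finset.Ico (L - 1 - K + 1) L).card := Finset.card_le_card fun a ha => by
          rw [Finset.mem_filter, Finset.mem_range] at ha
          rw [Finset.mem_Ico]
          omega
      _ ≤ K := by rw [Nat.card_Ico]; omega
  -- A square of `ρ` at the start of this row would have hook-length at most `(m - 1) + K = k`.
  have hρ : ρ.rowLen (L - 1 - K) = 0 := by
    by_contra hpos
    have h3 := h.lt_hook (L - 1 - K, 0)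
      (YoungDiagram.mem_iff_lt_rowLen.2 (Nat.pos_of_ne_zero hpos))
    rw [hookLen_eq, hr] at h3
    omega
  have e : skewCol γ ρ 0 = ((skewCells γ ρ).filter fun c => c.2 = 0 ∧ 0 ≤ c.1).card := by
    simp [skewCol]
  rw [hc, e, card_filter_skewCells hcell]
  calc K < (Finset.Ico (L - 1 - K) L).card := by rw [Nat.card_Ico]; omega
    _ ≤ _ := Finset.card_le_card fun a ha => by
      rw [Finset.mem_Ico] at ha
      have h4 := ρ.rowLen_anti _ _ ha.1
      have h5 : 0 < mu.shape.rowLen a := rowLen_pos_iff.2 ha.2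
      rw [Finset.mem_filter, Finset.mem_range, hr]
      omega

theorem NearRect.of_covers {k m K : ℕ} (hK : 1 ≤ K) (hmK : m + K = k + 1) {lam mu : Poset k}
    (hm : ∀ i, lam.shape.rowLen i ≤ m) (hlam : NearRect m K lam.shape) (h : Covers mu lam) :
    NearRect m K mu.shape := by
  intro i hi
  by_contra hne
  have h1 := lt_rowLen_kConj hmK
    (lt_of_le_of_ne ((le_iff_rowLen_le.1 h.1 i).trans (hm i)) hne) hi
  have h2 := rowLen_kConj_le_of_nearRect hK hmK hm hlam 0
  have h3 := le_iff_rowLen_le.1 h.2.1 0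
  omega

/-- The order ideal generated by `(m^n)` consists of the partitions inside the rectangle with at
most `k - m + 1` nonempty rows shorter than `m`. -/
theorem le_kRect_iff {k m K n : ℕ} (hmk : m ≤ k) (hK : 1 ≤ K) (hmK : m + K = k + 1)
    {lam : Poset k} :
    lam ≤ kRect hmk n ↔ lam.shape ≤ rect m n ∧ NearRect m K lam.shape := by
  have hwidth : ∀ {mu : YoungDiagram}, mu ≤ rect m n → ∀ i, mu.rowLen i ≤ m := fun h i =>
    (le_rect_iff.1 h i).trans (by split_ifs <;> omega)
  constructor
  · intro h
    have h' : Relation.ReflTransGen Covers lam (kRect hmk n) := h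
    induction h' using Relation.ReflTransGen.head_induction_on with
    | refl =>
      refine ⟨le_rfl, fun i hi => ?_⟩
      change 0 < (rect m n).rowLen (i + K) at hi
      change (rect m n).rowLen i = m
      rw [rowLen_rect] at hi ⊢
      split_ifs at hi
      · rw [if_pos (by omega)]
      · omega
    | head h1 h2 ih =>
      obtain ⟨h3, h4⟩ := ih h2
      exact ⟨h1.1.trans h3, h4.of_covers hK hmK (hwidth h3) h1⟩
  · suffices ∀ d (lam : Poset k), (rect m n).card ≤ lam.degree + d → lam.shape ≤ rect m n →
        NearRect m K lam.shape → lam ≤ kRect hmk n from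
      fun h => this _ lam (Nat.le_add_left _ _) h.1 h.2
    intro d
    induction d with
    | zero =>
      intro lam hd hle _
      have h : lam.shape = rect m n := YoungDiagram.ext
        (Finset.eq_of_subset_of_card_le (YoungDiagram.cells_subset_iff.2 hle) hd)
      obtain ⟨s, hs⟩ := lam
      subst h
      exact le_rfl
    | succ d ih =>
      intro lam hd hle hlam
      by_cases h : lam.shape = rect m n
      · obtain ⟨s, hs⟩ := lam
        subst h
        exact le_rfl
      · obtain ⟨mu, h1, h2, h3⟩ := exists_covers_of_ne_rect hK hmK hle hlam h
        have h4 : lam ≤ mu := Relation.ReflTransGen.single h1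
        exact h4.trans (ih mu (by rw [h1.2.2]; omega) h2 h3)

/-! ### The rank function -/

/-- A strictly monotone function to `ℕ` is the rank if every element where it does not vanish lies
above an element where its value is smaller by one. -/
theorem rank_eq_of_strictMono {α : Type*} [PartialOrder α] [Finite α] {f : α → ℕ}
    (hf : StrictMono f) (h : ∀ x, f x ≠ 0 → ∃ y < x, f x = f y + 1) (x : α) : rank x = f x := by
  have key : ∀ d x, f x = d → Order.height x = d := by
    intro d
    induction d with
    | zero =>
      intro x hx
      refine le_antisymm ?_ zero_le
      have := Order.height_le_height_apply_of_strictMono f hf x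
      rwa [Order.height_nat, hx] at this
    | succ d ih =>
      intro x hx
      obtain ⟨y, hyx, hy⟩ := h x (by omega)
      have h1 := Order.height_le_height_apply_of_strictMono f hf x
      have h2 := Order.height_add_one_le hyx
      rw [Order.height_nat, hx] at h1
      rw [ih y (by omega)] at h2
      exact le_antisymm h1 (by exact_mod_cast h2)
  rw [rank, key _ x rfl, ENat.toNat_natCast]

theorem rank_eq_degree {k m n : ℕ} (hmk : m ≤ k) (lam : Ideal hmk n) :
    rank lam = lam.1.degree := by
  refine rank_eq_of_strictMono (f := fun x : Ideal hmk n => x.1.degree) ?_ ?_ lam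
  · intro x y hxy
    rcases degree_le (show Relation.ReflTransGen Covers x.1 y.1 from hxy.le) with h | h
    · exact absurd (Subtype.ext h) hxy.ne
    · exact h
  · intro x hx
    have hmK : m + (k - m + 1) = k + 1 := by omega
    have hx' := (le_kRect_iff hmk (Nat.le_add_left 1 (k - m)) hmK).1 x.2
    obtain ⟨mu, hmu⟩ := exists_covers_of_nearRect (Nat.le_add_left 1 (k - m)) hmK
      (fun i => (le_rect_iff.1 hx'.1 i).trans (by split_ifs <;> omega)) hx'.2 hx
    have hle : mu ≤ x.1 := Relation.ReflTransGen.single hmu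
    refine ⟨⟨mu, hle.trans x.2⟩, lt_of_le_of_ne hle fun h => ?_, hmu.2.2⟩
    have h1 : mu = x.1 := congrArg Subtype.val h
    have h2 := hmu.2.2
    rw [h1] at h2
    omega

/-! ### Generating functions of partitions in a box -/

theorem finite_setOf_le (mu : YoungDiagram) : {lam : YoungDiagram | lam ≤ mu}.Finite :=
  Set.Finite.of_finite_image
    ((Finset.finite_toSet mu.cells.powerset).subset (by
      rintro _ ⟨lam, h, rfl⟩
      exact Finset.mem_coe.2 (Finset.mem_powerset.2 (YoungDiagram.cells_subset_iff.2 h))))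
    fun _ _ _ _ h => YoungDiagram.ext h

/-- The partitions with at most `n` parts, each at most `m`. -/
noncomputable def box (m n : ℕ) : Finset YoungDiagram := (finite_setOf_le (rect m n)).toFinset

theorem mem_box {lam : YoungDiagram} {m n : ℕ} :
    lam ∈ box m n ↔ ∀ i, lam.rowLen i ≤ if i < n then m else 0 := by
  rw [box, Set.Finite.mem_toFinset, Set.mem_ofPred_eq, le_rect_iff]

open Classical in
/-- The elements of the box with at most `K` nonempty rows shorter than `m`. -/
noncomputable def nearRects (m K n : ℕ) : Finset YoungDiagram := (box m n).filter (NearRect m K)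

/-- The generating function `∑ q^|lam|` of a finite set of partitions. -/
def genSum {R : Type*} [CommSemiring R] (q : R) (s : Finset YoungDiagram) : R :=
  ∑ lam ∈ s, q ^ lam.card

variable {R : Type*} [CommSemiring R] (q : R)

theorem genSum_box_of_mul_eq_zero {m n : ℕ} (h : m * n = 0) : genSum q (box m n) = 1 := by
  have hz : ∀ i, (if i < n then m else 0) = 0 := fun i => by
    rcases Nat.mul_eq_zero.1 h with rfl | rfl <;> simp
  have hb : box m n = {⊥} := by
    ext lam
    rw [mem_box, Finset.mem_singleton]
    simp only [hz]
    constructor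
    · refine fun hl => eq_of_rowLen fun i => ?_
      rw [Nat.le_zero.1 (hl i), eq_comm, rowLen_eq_zero]
      exact (Nat.eq_zero_of_not_pos fun hc => YoungDiagram.notMem_bot (0, 0)
        (YoungDiagram.mem_iff_lt_colLen.2 hc)).trans_le (Nat.zero_le _)
    · rintro rfl i
      by_contra hc
      exact YoungDiagram.notMem_bot (i, 0) (YoungDiagram.mem_iff_lt_rowLen.2 (not_le.1 hc))
  rw [hb, genSum, Finset.sum_singleton, YoungDiagram.card, YoungDiagram.cells_bot,
    Finset.card_empty, pow_zero]

/-- The partitions with `i` parts `m + 1` followed by `K` positive parts at most `m + 1` are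
obtained from the partitions in a box of width `m` by adding a cell to each of the `K` rows and
putting the `i` long rows before them. -/
theorem genSum_filter_box (m i K : ℕ) [DecidablePred fun lam : YoungDiagram =>
      (∀ a, a < i → lam.rowLen a = m + 1) ∧ ∀ a, a < i + K → 0 < lam.rowLen a] :
    genSum q ((box (m + 1) (i + K)).filter fun lam =>
      (∀ a, a < i → lam.rowLen a = m + 1) ∧ ∀ a, a < i + K → 0 < lam.rowLen a) =
      q ^ (i * (m + 1) + K) * genSum q (box m K) := by
  have hex : ∀ mu ∈ box m K, ∃ lam : YoungDiagram, ∀ a, lam.rowLen a =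
      if a < i then m + 1 else if a < i + K then mu.rowLen (a - i) + 1 else 0 := by
    intro mu hmu
    rw [mem_box] at hmu
    refine exists_rowLen_eq (N := i + K) (fun a b hab => ?_) fun a ha => ?_
    · have h1 := mu.rowLen_anti (a - i) (b - i) (by omega)
      have h2 := hmu (b - i)
      split_ifs at h2 ⊢ <;> omega
    · rw [if_neg (by omega), if_neg (by omega)]
  choose g hg using hex
  rw [genSum, genSum, Finset.mul_sum]
  symm
  refine Finset.sum_bij g ?_ ?_ ?_ ?_
  · intro mu hmu
    have h := hg mu hmu
    rw [mem_box] at hmu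
    rw [Finset.mem_filter, mem_box]
    refine ⟨fun a => ?_, fun a ha => ?_, fun a ha => ?_⟩
    · have h2 := hmu (a - i)
      rw [h]
      split_ifs at h2 ⊢ <;> omega
    · rw [h, if_pos ha]
    · rw [h]
      split_ifs <;> omega
  · intro mu hmu nu hnu e
    refine eq_of_rowLen fun a => ?_
    have h1 := hg mu hmu (i + a)
    have h2 := hg nu hnu (i + a)
    rw [mem_box] at hmu hnu
    have h3 := hmu a
    have h4 := hnu a
    rw [e, h2, Nat.add_sub_cancel_left] at h1
    split_ifs at h1 h3 h4 <;> omega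
  · intro lam hlam
    rw [Finset.mem_filter, mem_box] at hlam
    obtain ⟨h1, h2, h3⟩ := hlam
    obtain ⟨mu, hmu⟩ := exists_rowLen_eq (f := fun a => lam.rowLen (i + a) - 1) (N := K)
      (fun a b hab => Nat.sub_le_sub_right (lam.rowLen_anti _ _ (by omega)) 1) fun a ha => by
        have := h1 (i + a)
        rw [if_neg (by omega)] at this
        omega
    have hb : mu ∈ box m K := mem_box.2 fun a => by
      have := h1 (i + a)
      rw [hmu]
      split_ifs at this ⊢ <;> omega
    refine ⟨mu, hb, eq_of_rowLen fun a => ?_⟩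
    rw [hg mu hb, hmu]
    have h4 := h1 a
    split_ifs at h4 ⊢ with h5 h6 h6
    · exact (h2 a h5).symm
    · omega
    · have := h3 a h6
      rw [show i + (a - i) = a by omega]
      omega
    · omega
  · intro mu hmu
    have h := hg mu hmu
    have hz : ∀ a, K ≤ a → mu.rowLen a = 0 := fun a ha => by
      have := mem_box.1 hmu a
      rw [if_neg (by omega)] at this
      omega
    have hrow : ∀ a, a < K → (g mu hmu).rowLen (i + a) = mu.rowLen a + 1 := fun a ha => by
      rw [h, if_neg (by omega), if_pos (by omega), Nat.add_sub_cancel_left]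
    rw [card_eq_sum_rowLen (g mu hmu) (N := i + K) fun a ha => by
        rw [h, if_neg (by omega), if_neg (by omega)],
      card_eq_sum_rowLen mu hz, ← pow_add, Finset.sum_range_add,
      Finset.sum_congr rfl fun a ha => (h a).trans (if_pos (Finset.mem_range.1 ha)),
      Finset.sum_congr rfl fun a ha => hrow a (Finset.mem_range.1 ha)]
    simp only [Finset.sum_add_distrib, Finset.sum_const, Finset.card_range, smul_eq_mul, mul_one]
    congr 1
    ring

theorem genSum_eq_add (s : Finset YoungDiagram) (n : ℕ) :
    genSum q s = genSum q (s.filter fun lam => lam.rowLen n = 0) +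
      genSum q (s.filter fun lam => ¬ lam.rowLen n = 0) :=
  (Finset.sum_filter_add_sum_filter_not s _ _).symm

theorem filter_box_rowLen_eq_zero (m n : ℕ) :
    ((box m (n + 1)).filter fun lam => lam.rowLen n = 0) = box m n := by
  ext lam
  rw [Finset.mem_filter, mem_box, mem_box]
  constructor
  · rintro ⟨h1, h2⟩ i
    have h3 := h1 i
    by_cases hi : i = n
    · subst hi; omega
    · split_ifs at h3 ⊢ <;> omega
  · intro h
    refine ⟨fun i => ?_, ?_⟩
    · have := h i
      split_ifs at this ⊢ <;> omega
    · simpa using h n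

/-- The `q`-Pascal recursion: a partition either has an empty last row or a full first column. -/
theorem genSum_box_succ (m n : ℕ) :
    genSum q (box (m + 1) (n + 1)) =
      genSum q (box (m + 1) n) + q ^ (n + 1) * genSum q (box m (n + 1)) := by
  classical
  have h := genSum_filter_box q m 0 (n + 1)
  rw [zero_mul, zero_add] at h
  rw [genSum_eq_add q _ n, filter_box_rowLen_eq_zero, ← h]
  congr 2
  refine Finset.filter_congr fun lam _ => ⟨fun h0 => ⟨fun a ha => absurd ha (Nat.not_lt_zero a),
    fun a ha => ?_⟩, fun h0 => (h0.2 n (Nat.lt_succ_self n)).ne'⟩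
  exact (Nat.pos_of_ne_zero h0).trans_le (lam.rowLen_anti _ _ (by omega))

/-! ### Generating functions of the order ideals -/

theorem nearRects_self (m K : ℕ) : nearRects m K K = box m K := by
  classical
  rw [nearRects, Finset.filter_true_of_mem]
  intro lam hlam i hi
  have := mem_box.1 hlam (i + K)
  rw [if_neg (by omega)] at this
  omega

/-- Raising the height of the rectangle adds the partitions that use its last row. They have `K`
positive rows at the end, and all rows before these are equal to `m + 1`. -/
theorem genSum_nearRects_succ (m K N : ℕ) :
    genSum q (nearRects (m + 1) K (K + (N + 1))) = genSum q (nearRects (m + 1) K (K + N)) +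
      q ^ ((N + 1) * (m + 1) + K) * genSum q (box m K) := by
  classical
  rw [genSum_eq_add q _ (K + N), ← genSum_filter_box q m (N + 1) K,
    show N + 1 + K = K + (N + 1) by ring]
  congr 2
  · rw [nearRects, nearRects, ← filter_box_rowLen_eq_zero _ (K + N), Finset.filter_filter,
      Finset.filter_filter, ← add_assoc]
    simp only [and_comm]
  · rw [nearRects, Finset.filter_filter]
    refine Finset.filter_congr fun lam hlam => ⟨fun h => ?_, fun h => ⟨fun i hi => ?_, ?_⟩⟩
    · have hpos : ∀ a, a < K + (N + 1) → 0 < lam.rowLen a := fun a ha =>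
        (Nat.pos_of_ne_zero h.2).trans_le (lam.rowLen_anti _ _ (by omega))
      exact ⟨fun a ha => h.1 a (hpos _ (by omega)), hpos⟩
    · refine h.1 i ?_
      by_contra hc
      have := mem_box.1 hlam (i + K)
      rw [if_neg (by omega)] at this
      omega
    · exact (h.2 _ (by omega)).ne'

theorem genSum_nearRects (m K N : ℕ) :
    genSum q (nearRects (m + 1) K (K + N)) = genSum q (box (m + 1) K) +
      (∑ i ∈ Finset.range N, q ^ ((i + 1) * (m + 1) + K)) * genSum q (box m K) := by
  induction N with
  | zero => rw [add_zero, nearRects_self, Finset.sum_range_zero, zero_mul, add_zero]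
  | succ N ih => rw [genSum_nearRects_succ, ih, Finset.sum_range_succ,
    add_mul (∑ i ∈ Finset.range N, _), add_assoc]

theorem sum_ideal_eq_genSum {k m n : ℕ} (hmk : m ≤ k) :
    ∑ lam : Ideal hmk n, q ^ lam.1.degree = genSum q (nearRects m (k - m + 1) n) := by
  classical
  have hmem : ∀ {lam : Poset k}, lam ≤ kRect hmk n ↔ lam.shape ∈ nearRects m (k - m + 1) n :=
    fun {lam} => by
      rw [le_kRect_iff hmk (Nat.le_add_left 1 (k - m)) (by omega), nearRects, Finset.mem_filter,
        mem_box, le_rect_iff]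
  refine Finset.sum_bij (fun x _ => x.1.shape) (fun x _ => hmem.1 x.2) ?_ ?_ fun _ _ => rfl
  · rintro ⟨⟨s, hs⟩, hx⟩ _ ⟨⟨t, ht⟩, hy⟩ _ (rfl : s = t)
    rfl
  · intro lam hlam
    have hb : IsBounded k lam := by
      rw [nearRects, Finset.mem_filter, mem_box] at hlam
      exact (hlam.1 0).trans (by split_ifs <;> omega)
    exact ⟨⟨⟨lam, hb⟩, hmem.2 hlam⟩, Finset.mem_univ _, rfl⟩

/-! ### `q`-binomial coefficients -/

theorem one_sub_X_pow_ne_zero {a : ℕ} (ha : a ≠ 0) : (1 - RatFunc.X ^ a : RatFunc ℚ) ≠ 0 := by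
  rw [sub_ne_zero, ← RatFunc.algebraMap_X, ← map_pow, ne_comm, Ne,
    map_eq_one_iff _ (RatFunc.algebraMap_injective ℚ)]
  intro h
  have := congrArg Polynomial.natDegree h
  rw [Polynomial.natDegree_X_pow, Polynomial.natDegree_one] at this
  exact ha this

theorem qBinom_zero_right (a : ℕ) : qBinom a 0 = 1 := by
  simp [qBinom]

theorem qBinom_self (a : ℕ) : qBinom a a = 1 := by
  have h : ∏ i ∈ Finset.range a, (1 - RatFunc.X ^ (a - i) : RatFunc ℚ) =
      ∏ i ∈ Finset.range a, (1 - RatFunc.X ^ (i + 1)) := by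
    rw [← Finset.prod_range_reflect]
    refine Finset.prod_congr rfl fun i hi => ?_
    rw [Finset.mem_range] at hi
    rw [show a - (a - 1 - i) = i + 1 by omega]
  rw [qBinom, h, div_self]
  exact Finset.prod_ne_zero_iff.2 fun i _ => one_sub_X_pow_ne_zero (Nat.succ_ne_zero i)

theorem qBinom_succ_right (a b : ℕ) :
    qBinom a (b + 1) = qBinom a b * ((1 - RatFunc.X ^ (a - b)) / (1 - RatFunc.X ^ (b + 1))) := by
  rw [qBinom, qBinom, Finset.prod_range_succ, Finset.prod_range_succ, mul_div_mul_comm]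

theorem qBinom_succ_succ (a b : ℕ) :
    qBinom (a + 1) (b + 1) =
      qBinom a b * ((1 - RatFunc.X ^ (a + 1)) / (1 - RatFunc.X ^ (b + 1))) := by
  rw [qBinom, qBinom, Finset.prod_range_succ', Finset.prod_range_succ (fun i => _ - _ ^ (i + 1)),
    mul_div_mul_comm, Nat.sub_zero]
  simp only [Nat.add_sub_add_right]

/-- The recursion of `genSum_box_succ` for `q`-binomial coefficients. -/
theorem qBinom_pascal (m n : ℕ) :
    qBinom (m + 1 + (n + 1)) (m + 1) =
      qBinom (m + 1 + n) (m + 1) + RatFunc.X ^ (n + 1) * qBinom (m + (n + 1)) m := by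
  have h := one_sub_X_pow_ne_zero (Nat.succ_ne_zero m)
  rw [show m + 1 + (n + 1) = m + (n + 1) + 1 by ring, show m + 1 + n = m + (n + 1) by ring,
    qBinom_succ_succ, qBinom_succ_right, Nat.add_sub_cancel_left]
  field_simp
  ring

theorem genSum_X_box (m n : ℕ) :
    genSum (RatFunc.X : RatFunc ℚ) (box m n) = qBinom (m + n) m := by
  induction m generalizing n with
  | zero => rw [genSum_box_of_mul_eq_zero _ (Nat.zero_mul n), qBinom_zero_right]
  | succ m ihm =>
    induction n with
    | zero => rw [genSum_box_of_mul_eq_zero _ (Nat.mul_zero _), add_zero, qBinom_self]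
    | succ n ihn => rw [genSum_box_succ, ihn, ihm, qBinom_pascal]

theorem genSum_one_box (m n : ℕ) : genSum (1 : ℕ) (box m n) = (m + n).choose m := by
  induction m generalizing n with
  | zero => rw [genSum_box_of_mul_eq_zero _ (Nat.zero_mul n), Nat.choose_zero_right]
  | succ m ihm =>
    induction n with
    | zero => rw [genSum_box_of_mul_eq_zero _ (Nat.mul_zero _), add_zero, Nat.choose_self]
    | succ n ihn =>
      rw [genSum_box_succ, ihn, ihm, one_pow, one_mul,
        show m + 1 + (n + 1) = m + (n + 1) + 1 by ring, show m + 1 + n = m + (n + 1) by ring,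
        Nat.choose_succ_succ, add_comm]

theorem sum_X_pow_arith_progression {m : ℕ} (hm : m ≠ 0) (K N : ℕ) :
    ∑ i ∈ Finset.range N, (RatFunc.X : RatFunc ℚ) ^ ((i + 1) * m + K) =
      RatFunc.X ^ (m + K) * ((1 - RatFunc.X ^ (m * N)) / (1 - RatFunc.X ^ m)) := by
  have h := one_sub_X_pow_ne_zero hm
  have hg := geom_sum_mul_neg ((RatFunc.X : RatFunc ℚ) ^ m) N
  rw [pow_mul, ← hg, mul_div_assoc, div_self h, mul_one, Finset.mul_sum]
  refine Finset.sum_congr rfl fun i _ => ?_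
  ring

end KYoung

theorem mainTheorem4 (k m n : ℕ) (hm : 1 ≤ m) (hmk : m ≤ k) (hn : k - m + 1 ≤ n) :
    (∀ lam : KYoung.Ideal hmk n, KYoung.rank lam = lam.1.degree) ∧
    algebraMap (Polynomial ℚ) (RatFunc ℚ) (KYoung.rankGen (KYoung.Ideal hmk n)) =
      KYoung.qBinom (k + 1) m +
        RatFunc.X ^ (k + 1) * ((1 - RatFunc.X ^ (m * (n + m - (k + 1)))) / (1 - RatFunc.X ^ m)) *
          KYoung.qBinom k (m - 1) ∧
    Fintype.card (KYoung.Ideal hmk n) =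
      Nat.choose (k + 1) m + (n + m - (k + 1)) * Nat.choose k (m - 1) := by
  obtain ⟨N, hN⟩ := Nat.exists_eq_add_of_le hn
  obtain ⟨m, rfl⟩ := Nat.exists_eq_add_of_le' hm
  have e1 : m + 1 + (k - (m + 1) + 1) = k + 1 := by omega
  have e2 : m + (k - (m + 1) + 1) = k := by omega
  have e3 : n + (m + 1) - (k + 1) = N := by omega
  have hgen {R : Type} [CommSemiring R] (q : R) : ∑ lam : KYoung.Ideal hmk n, q ^ lam.1.degree =
      KYoung.genSum q (KYoung.box (m + 1) (k - (m + 1) + 1)) +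
        (∑ i ∈ Finset.range N, q ^ ((i + 1) * (m + 1) + (k - (m + 1) + 1))) *
          KYoung.genSum q (KYoung.box m (k - (m + 1) + 1)) := by
    rw [KYoung.sum_ideal_eq_genSum, ← KYoung.genSum_nearRects, ← hN]
  refine ⟨KYoung.rank_eq_degree hmk, ?_, ?_⟩
  · simp only [KYoung.rankGen, map_sum, map_pow, RatFunc.algebraMap_X, KYoung.rank_eq_degree]
    rw [hgen, KYoung.genSum_X_box, KYoung.genSum_X_box,
      KYoung.sum_X_pow_arith_progression (Nat.succ_ne_zero m), e1, e2, e3, Nat.add_sub_cancel]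
  · have h := hgen (1 : ℕ)
    simp only [one_pow, Finset.sum_const, smul_eq_mul, mul_one, Finset.card_range,
      Finset.card_univ, KYoung.genSum_one_box, e1, e2] at h
    rw [h, e3, Nat.add_sub_cancel]
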